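/- **Model (discrete time, $\mathbb T=\mathbb N\cup\{0\}$).** A context $\gamma$ consists of a directed graph on a (possibly infinite) set of agents, whose edges $(i,j)$ carry bounds $b(i,j)\in\{1,2,\dots\}\cup\{\infty\}$; a set $S_i$ of states for each agent $i$; a set of messages; and a set of external inputs, each observed by one agent. The model may or may not be a shared-clock one. At each time, each agent observes a set of external inputs and of delivered messages (each with its sender), and, as a function (given by its protocol) of its previous state (initially, one of a given set of initial states), of these observations and, in a shared-clock model only, of the time, it sets its new state, sends a set of messages to neighbours, and possibly responds. In a run, each external input occurs at most once, exactly the sent messages are delivered, each exactly once, and a message sent at $t$ from $i$ to $j$ arrives at some $t'$ with $t<t'\le t+b(i,j)$. Let $R(P)$ be the set of runs of the protocol $P$ (initial states, states, external inputs and deliveries). A run is *triggered* if the external input $\tilde e$ occurs in it. $P$ is a *full-information* protocol if the state of each agent (with the time, in a shared-clock model) always determines its initial state and its sequence of observations so far, and if at each time each agent sends every neighbour a message from which its current state (and the time, in a shared-clock model) can be decoded. (In a shared-clock model the sequence of observations has an entry for every time; otherwise steps at which the agent observes nothing, keeps its state and does not respond are left out.) **The problem.** Let $\tilde e$ be an external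 input, $I$ a set of agents with $|I|>1$, and let $\delta(i,j)\in\mathbb Z\cup\{-\infty,\infty\}$ for all distinct $i,j\in I$. A protocol solves $\mathrm{TCR}(\tilde e,I,\delta)$ if in each of its triggered runs each $i\in I$ responds exactly once, at a time $\mathsf t(i)\in\mathbb T$, where $\mathsf t(j)\le \mathsf t(i)+\delta(i,j)$ for all distinct $i,j\in I$, and if no $i\in I$ responds in any other run. **Knowledge.** Fix $P$. Events are subsets of $R(P)\times\mathbb T$. $K_i(\psi)$ is the set of points $p$ such that $q\in\psi$ for every point $q$ at which the state of $i$ (and, in a shared-clock model, the time) is the same as at $p$. For $\varepsilon\in\mathbb Z\cup\{-\infty,\infty\}$ let $\circledcirc^{\le\varepsilon}\psi$ be the set of points $(r,t)$ for which there is $t'\in\mathbb T$ with $t'\le t+\varepsilon$ and $(r,t')\in\psi$. Let $C_I^\delta(\psi)=(C_I^\delta(\psi)_i)_{i\in I}$ be the greatest fixed point (for coordinatewise inclusion) of $$(x_i)_{i\in I}\mapsto\Bigl(\bigcap_{j\in I\setminus\{i\}}\circledcirc^{\le\delta(i,j)}K_j(\psi\cap x_j)\Bigr)_{i\in I}.$$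 Identify $\tilde e$ with the event that it is occurring now. **Theorem.** For all $\gamma,\tilde e,I,\delta$ as above, "each $i\in I$ responds when $K_i\bigl(C_I^\delta(\circledcirc^{\le 0}\tilde e)_i\bigr)$ holds for the first time" is an optimal response logic for solving $\mathrm{TCR}(\tilde e,I,\delta)$. That is, let $P$ be any full-information protocol that solves $\mathrm{TCR}(\tilde e,I,\delta)$. Then: 1. There is a protocol $P'$ that differs from $P$ only in when the agents of $I$ respond (hence $R(P')=R(P)$), and in every run of which each $i\in I$ responds exactly at the first time, if any, at which $K_i\bigl(C_I^\delta(\circledcirc^{\le 0}\tilde e)_i\bigr)$, computed in $R(P)$, holds. 2. Every such $P'$ solves $\mathrm{TCR}(\tilde e,I,\delta)$. 3. For every such $P'$, every $r\in R(P)$ and every $i\in I$, the response time of $i$ in $r$ under $P'$ is at most its response time in $r$ under $P$ (response times being $\infty$ in runs that are not triggered). -/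

import Mathlib

universe u1 u2 u3 u4

/-- A context of the discrete-time model: a weighted directed graph on the set of agents, with
positive integral or infinite weights (maximal delivery times), the sets of states, of messages
and of external inputs, and the agent that observes each external input.  The field `sharedClock`
says whether the model is a shared-clock model.  Times are natural numbers. -/
structure Context where
  Agent : Type u1
  Neighbour : Agent → Agent → Prop
  bound : Agent → Agent → ℕ∞
  bound_pos : ∀ i j, Neighbour i j → 0 < bound i j
  State : Agent → Type u2
  Message : Type u3
  Input : Type u4
  observer : Input → Agent
  sharedClock : Prop

namespace Context

/-- A message delivery event: a message `content`, sent by `src` to its neighbour `dst` at time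
`sentAt`. -/
structure Delivery (γ : Context.{u1, u2, u3, u4}) where
  content : γ.Message
  sentAt : ℕ
  src : γ.Agent
  dst : γ.Agent
  edge : γ.Neighbour src dst

/-- What agent `i` observes at one time: a set of external inputs, and a set of delivered
messages, each with its sender. -/
abbrev Observation (γ : Context.{u1, u2, u3, u4}) (i : γ.Agent) :=
  Set {e : γ.Input // γ.observer e = i} × Set (γ.Message × γ.Agent)

/-- An action of agent `i`: its new state, the messages that it sends, and whether it responds. -/
structure Action (γ : Context.{u1, u2, u3, u4}) (i : γ.Agent) where
  newState : γ.State i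
  sends : Set (γ.Message × {j : γ.Agent // γ.Neighbour i j})
  respond : Prop

/-- A joint protocol: for each agent, a set of possible initial states, and an action function.
The action may depend on the current time only in a shared-clock model. -/
structure Protocol (γ : Context.{u1, u2, u3, u4}) where
  initial : ∀ i : γ.Agent, Set (γ.State i)
  act : ∀ i : γ.Agent, γ.State i → γ.Observation i → ℕ → γ.Action i
  clockless : ¬ γ.sharedClock → ∀ i s o t t', act i s o t = act i s o t'

/-- The raw data of a run: the initial states that are used, the state of each agent at each
time, and the state of the environment (external inputs and deliveries) at each time. -/
structure Trace (γ : Context.{u1, u2, u3, u4}) where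
  initial : ∀ i : γ.Agent, γ.State i
  state : ℕ → ∀ i : γ.Agent, γ.State i
  inputs : ℕ → Set γ.Input
  deliveries : ℕ → Set γ.Delivery

end Context

namespace Context.Trace

variable {γ : Context.{u1, u2, u3, u4}}

/-- The state of `i` just before time `t`. -/
def before (r : γ.Trace) (i : γ.Agent) : ℕ → γ.State i
  | 0 => r.initial i
  | t + 1 => r.state t i

/-- The events observed by `i` at time `t`. -/
def observed (r : γ.Trace) (i : γ.Agent) (t : ℕ) : γ.Observation i :=
  ({e | e.1 ∈ r.inputs t},
    {p | ∃ d ∈ r.deliveries t, d.dst = i ∧ d.content = p.1 ∧ d.src = p.2})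

/-- The external input `e` occurs in `r`. -/
def Triggered (r : γ.Trace) (e : γ.Input) : Prop := ∃ t, e ∈ r.inputs t

end Context.Trace

namespace Context.Protocol

variable {γ : Context.{u1, u2, u3, u4}}

/-- The action that `i` takes at time `t` in `r`, according to `P`. -/
def actionAt (P : γ.Protocol) (r : γ.Trace) (i : γ.Agent) (t : ℕ) : γ.Action i :=
  P.act i (r.before i t) (r.observed i t) t

/-- The message of `d` is sent in `r`, according to `P`. -/
def Sent (P : γ.Protocol) (r : γ.Trace) (d : γ.Delivery) : Prop :=
  (d.content, ⟨d.dst, d.edge⟩) ∈ (P.actionAt r d.src d.sentAt).sends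

/-- `i` responds at time `t` in `r`, according to `P`. -/
def Responds (P : γ.Protocol) (r : γ.Trace) (i : γ.Agent) (t : ℕ) : Prop :=
  (P.actionAt r i t).respond

/-- `r` is a run of `P`. -/
structure IsRun (P : γ.Protocol) (r : γ.Trace) : Prop where
  initial_mem : ∀ i, r.initial i ∈ P.initial i
  state_eq : ∀ t i, r.state t i = (P.actionAt r i t).newState
  input_once : ∀ e t t', e ∈ r.inputs t → e ∈ r.inputs t' → t = t'
  delivered_once : ∀ d, P.Sent r d → ∃! t, d ∈ r.deliveries t
  delivered_sent : ∀ d t, d ∈ r.deliveries t → P.Sent r d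
  delivered_in_time : ∀ d t, d ∈ r.deliveries t →
    d.sentAt < t ∧ (t : ℕ∞) ≤ (d.sentAt : ℕ∞) + γ.bound d.src d.dst

/-- The set of all runs of `P`. -/
def runs (P : γ.Protocol) : Set γ.Trace := {r | P.IsRun r}

/-! ### Full-information protocols -/

/-- Nothing happens to `i` at time `t`: it observes no event, keeps its state and does not
respond. -/
def Idle (P : γ.Protocol) (r : γ.Trace) (i : γ.Agent) (t : ℕ) : Prop :=
  r.observed i t = (∅, ∅) ∧ r.state t i = r.before i t ∧ ¬ P.Responds r i t

open Classical in
/-- The local history of `i` up to and including `t`: its initial state, and the list of what it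
observed.  In a shared-clock model the list has one entry for each of the times `0, …, t`, so that
it tells when each event was observed; without a shared clock, idle steps leave no entry. -/
noncomputable def localHistory (P : γ.Protocol) (r : γ.Trace) (i : γ.Agent) (t : ℕ) :
    γ.State i × List (γ.Observation i) :=
  (r.initial i,
    ((List.range (t + 1)).filter fun u => decide (γ.sharedClock ∨ ¬ P.Idle r i u)).map
      (r.observed i))

/-- `P` is a full-information protocol: the state of each agent (together with the current time,
in a shared-clock model) determines its local history, and at every time each agent sends to
every neighbour a message that includes its current state (and the current time, in a
shared-clock model), i.e. from which these can be decoded. -/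
structure FullInformation (P : γ.Protocol) : Prop where
  remembers : ∀ i, ∀ r ∈ P.runs, ∀ s ∈ P.runs, ∀ t t', r.state t i = s.state t' i →
    (γ.sharedClock → t = t') → P.localHistory r i t = P.localHistory s i t'
  informs : ∀ i, ∃ decode : γ.Message → γ.State i × ℕ, ∀ r ∈ P.runs, ∀ t,
    ∀ j : {j : γ.Agent // γ.Neighbour i j}, ∃ m, (m, j) ∈ (P.actionAt r i t).sends ∧
      (decode m).1 = r.state t i ∧ (γ.sharedClock → (decode m).2 = t)

/-! ### Response times, and modification of the response logic -/

/-- The response time of `i` in `r` (the time of the first response, and `⊤` if there is none). -/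
noncomputable def responseTime (P : γ.Protocol) (r : γ.Trace) (i : γ.Agent) : ℕ∞ :=
  ⨅ (t : ℕ) (_ : P.Responds r i t), (t : ℕ∞)

/-- `P'` is obtained from `P` by modifying only the response logic of the agents in `I`. -/
structure ModifiesResponses (P P' : γ.Protocol) (I : Set γ.Agent) : Prop where
  initial_eq : ∀ i, P'.initial i = P.initial i
  newState_eq : ∀ i s o t, (P'.act i s o t).newState = (P.act i s o t).newState
  sends_eq : ∀ i s o t, (P'.act i s o t).sends = (P.act i s o t).sends
  respond_eq : ∀ i, i ∉ I → ∀ s o t, (P'.act i s o t).respond ↔ (P.act i s o t).respond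

/-- A trace does not record responses, so the natural isomorphism between the sets of runs of two
protocols that differ only in their response logic is the identity. -/
theorem ModifiesResponses.runs_eq {P P' : γ.Protocol} {I : Set γ.Agent}
    (h : P.ModifiesResponses P' I) : P'.runs = P.runs := by
  have hs : ∀ r d, P'.Sent r d ↔ P.Sent r d := fun r d => by
    simp only [Sent, actionAt, h.sends_eq]
  have hn : ∀ r i t, (P'.actionAt r i t).newState = (P.actionAt r i t).newState :=
    fun r i t => h.newState_eq _ _ _ _
  ext r
  constructor
  · rintro ⟨a, b, c, d, e, f⟩
    exact ⟨fun i => h.initial_eq i ▸ a i, fun t i => (b t i).trans (hn r i t), c,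
      fun x hx => d x ((hs r x).2 hx), fun x t hx => (hs r x).1 (e x t hx), f⟩
  · rintro ⟨a, b, c, d, e, f⟩
    exact ⟨fun i => (h.initial_eq i).symm ▸ a i, fun t i => (b t i).trans (hn r i t).symm, c,
      fun x hx => d x ((hs r x).1 hx), fun x t hx => (hs r x).2 (e x t hx), f⟩

end Context.Protocol

/-! ### Timely-coordinated response -/

/-- The set `ℤ ∪ {-∞, ∞}` of possible constraints. -/
abbrev TimeBound := WithBot (WithTop ℤ)

/-- `t'` is at most `t + ε`. -/
def NoLaterThan (t' t : ℕ) (ε : TimeBound) : Prop :=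
  (((t' : ℤ) : WithTop ℤ) : TimeBound) ≤ (((t : ℤ) : WithTop ℤ) : TimeBound) + ε

/-- The implementations of a constraining function `δ`; only the values of `δ` at pairs of
distinct elements matter. -/
def implementations {ι : Type*} (δ : ι → ι → TimeBound) : Set (ι → ℕ) :=
  {τ | ∀ i j, i ≠ j → NoLaterThan (τ j) (τ i) (δ i j)}

section Problems

variable {γ : Context.{u1, u2, u3, u4}}

/-- The eventual response problem: in each triggered run each `i ∈ I` responds exactly once, and
in every other run no `i ∈ I` responds. -/
def eventualResponse (e : γ.Input) (I : Set γ.Agent) : Set γ.Protocol :=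
  {P | ∀ r ∈ P.runs,
    (r.Triggered e → ∀ i ∈ I, ∃! t, P.Responds r i t) ∧
    (¬ r.Triggered e → ∀ i ∈ I, ∀ t, ¬ P.Responds r i t)}

/-- The timely-coordinated response problem: the protocols that solve the eventual response
problem, and for which the response times in each triggered run are an implementation of `δ`. -/
def timelyResponse (e : γ.Input) (I : Set γ.Agent) (δ : I → I → TimeBound) : Set γ.Protocol :=
  {P | P ∈ eventualResponse e I ∧ ∀ r ∈ P.runs, r.Triggered e →
    ∃ τ ∈ implementations δ, ∀ i : I, P.responseTime r i = (τ i : ℕ∞)}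

/-! ### Events and knowledge -/

/-- Events over a set `R` of runs: sets of points, i.e. of run-time pairs. -/
abbrev Event (R : Set γ.Trace) := Set (↥R × ℕ)

/-- `i` cannot distinguish `p` from `q`: its state is the same at both and, in a shared-clock
model, so is the time. -/
def Indistinguishable {R : Set γ.Trace} (i : γ.Agent) (p q : ↥R × ℕ) : Prop :=
  p.1.1.state p.2 i = q.1.1.state q.2 i ∧ (γ.sharedClock → p.2 = q.2)

/-- The event that `i` knows `ψ`. -/
def knows {R : Set γ.Trace} (i : γ.Agent) (ψ : Event R) : Event R :=
  {p | ∀ q, Indistinguishable i p q → q ∈ ψ}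

/-- The event that `ψ` holds at some time no later than `ε` time units from now. -/
def byTime {R : Set γ.Trace} (ε : TimeBound) (ψ : Event R) : Event R :=
  {p | ∃ t' : ℕ, NoLaterThan t' p.2 ε ∧ (p.1, t') ∈ ψ}

/-- The event that the external input `e` is occurring now. -/
def occurring (R : Set γ.Trace) (e : γ.Input) : Event R := {p | e ∈ p.1.1.inputs p.2}

theorem knows_mono {R : Set γ.Trace} (i : γ.Agent) {ψ φ : Event R} (h : ψ ⊆ φ) :
    knows i ψ ⊆ knows i φ := fun _ hp q hq => h (hp q hq)

theorem byTime_mono {R : Set γ.Trace} (ε : TimeBound) {ψ φ : Event R} (h : ψ ⊆ φ) :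
    byTime ε ψ ⊆ byTime ε φ := fun _ ⟨t', ht, hp⟩ => ⟨t', ht, h hp⟩

/-- The function on `I`-tuples of events whose greatest fixed point is `δ`-common knowledge of
`ψ`. -/
def deltaStep {R : Set γ.Trace} (I : Set γ.Agent) (δ : I → I → TimeBound) (ψ : Event R) :
    (I → Event R) →o (I → Event R) where
  toFun x i := ⋂ (j : I) (_ : j ≠ i), byTime (δ i j) (knows j.1 (ψ ∩ x j))
  monotone' _ _ hxy i := Set.iInter_mono fun j => Set.iInter_mono fun _ =>
    byTime_mono _ (knows_mono _ (Set.inter_subset_inter_right ψ (hxy j)))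

/-- `δ`-common knowledge of `ψ` by `I`: the greatest fixed point of `deltaStep I δ ψ`. -/
def deltaCommonKnowledge {R : Set γ.Trace} (I : Set γ.Agent) (δ : I → I → TimeBound)
    (ψ : Event R) : I → Event R :=
  OrderHom.gfp (deltaStep I δ ψ)

/-- The event that `ψ` holds now for the first time. -/
def firstTime {R : Set γ.Trace} (ψ : Event R) : Event R :=
  {p | p ∈ ψ ∧ ∀ t < p.2, (p.1, t) ∉ ψ}

/-! ### Optimal response logics -/

/-- A response logic `L` for `I` says, for each protocol `P` and each `i ∈ I`, at which points of
the runs of `P` agent `i` should respond.  `P'` is the result of endowing `P` with `L`. -/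
def EndowedWith (I : Set γ.Agent) (L : ∀ P : γ.Protocol, I → Event P.runs)
    (P P' : γ.Protocol) : Prop :=
  P.ModifiesResponses P' I ∧
    ∀ (r : P.runs) (i : I) (t : ℕ), P'.Responds r.1 i t ↔ (r, t) ∈ L P i

/-- `L` is an optimal response logic for solving the coordinated response problem `CP`: every
full-information protocol `P` that solves `CP` can be endowed with `L`, and the resulting protocol
solves `CP`, with response times that are, in each run, no later than those of `P`. -/
def IsOptimalResponseLogic (CP : Set γ.Protocol) (I : Set γ.Agent)
    (L : ∀ P : γ.Protocol, I → Event P.runs) : Prop :=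
  ∀ P ∈ CP, P.FullInformation →
    (∃ P', EndowedWith I L P P') ∧
    ∀ P', EndowedWith I L P P' →
      P' ∈ CP ∧ ∀ r ∈ P.runs, ∀ i ∈ I, P'.responseTime r i ≤ P.responseTime r i

end Problems

/-! In a solution `P`, the events "agent `k` has responded" form a post-fixed point of `deltaStep`.
By full information a responding agent knows that it has responded and that the trigger has
occurred, and `δ` bounds the other response times. Hence this tuple lies below the greatest fixed
point, and whoever responds under `P` already knows its component of `δ`-common knowledge
(`knows_deltaCommonKnowledge_of_responds`). So the new responses exist in triggered runs and are
never later than the old ones. Conversely, if `k` knows its component, then that component is true.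
The fixed point equation then gives each other `j` a time within `δ k j` at which `j` knows its own
component, so `j` has responded by then. The equation also forces the trigger. It remains to see
that "for the first time" is a legitimate response rule, depending on local data only
(`firstTime_knows_congr`). By perfect recall (`IsRun.recall`) the relevant knowledge is never lost,
so only the preceding state has to be inspected. Causality is supplied by the runs `quiet`, where
inputs cease at a given time. -/

namespace Context.Trace

variable {γ : Context.{u1, u2, u3, u4}}

/-- Two traces with the same inputs and deliveries at `t` look alike to every agent at `t`. -/
theorem observed_congr {r s : γ.Trace} {t : ℕ} (hi : r.inputs t = s.inputs t)
    (hd : r.deliveries t = s.deliveries t) (i : γ.Agent) : r.observed i t = s.observed i t := by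
  simp only [observed, hi, hd]

end Context.Trace

namespace Context.Protocol

variable {γ : Context.{u1, u2, u3, u4}} {P : γ.Protocol} {r s : γ.Trace} {i : γ.Agent}

theorem act_congr (P : γ.Protocol) (i : γ.Agent) (x : γ.State i) (o : γ.Observation i) {t t' : ℕ}
    (h : γ.sharedClock → t = t') : P.act i x o t = P.act i x o t' := by
  by_cases hc : γ.sharedClock
  · rw [h hc]
  · exact P.clockless hc i x o t t'

theorem actionAt_congr {t t' : ℕ} (hb : r.before i t = s.before i t')
    (ho : r.observed i t = s.observed i t') (h : γ.sharedClock → t = t') :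
    P.actionAt r i t = P.actionAt s i t' := by
  simp only [actionAt, hb, ho]
  exact P.act_congr i _ _ h

/-! ### Perfect recall -/

/-- The step of `i` at time `t` leaves an entry in its local history. -/
def Active (P : γ.Protocol) (r : γ.Trace) (i : γ.Agent) (t : ℕ) : Prop :=
  γ.sharedClock ∨ ¬ P.Idle r i t

open Classical in
/-- The observations recorded by `i` before time `n`. -/
noncomputable def recorded (P : γ.Protocol) (r : γ.Trace) (i : γ.Agent) (n : ℕ) :
    List (γ.Observation i) :=
  ((List.range n).filter fun u => decide (γ.sharedClock ∨ ¬ P.Idle r i u)).map (r.observed i)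

theorem localHistory_eq (P : γ.Protocol) (r : γ.Trace) (i : γ.Agent) (t : ℕ) :
    P.localHistory r i t = (r.initial i, P.recorded r i (t + 1)) := rfl

theorem recorded_zero : P.recorded r i 0 = [] := rfl

theorem recorded_succ_of_active {n : ℕ} (h : P.Active r i n) :
    P.recorded r i (n + 1) = P.recorded r i n ++ [r.observed i n] := by
  have h' : γ.sharedClock ∨ ¬ P.Idle r i n := h
  simp [recorded, List.range_succ, List.filter_append, h']

theorem recorded_succ_of_not_active {n : ℕ} (h : ¬ P.Active r i n) :
    P.recorded r i (n + 1) = P.recorded r i n := by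
  have h' : ¬ (γ.sharedClock ∨ ¬ P.Idle r i n) := h
  simp [recorded, List.range_succ, List.filter_append, h']

theorem before_succ_of_not_active {n : ℕ} (h : ¬ P.Active r i n) :
    r.before i (n + 1) = r.before i n :=
  (not_not.1 (not_or.1 h).2).2.1

theorem not_sharedClock_of_not_active {n : ℕ} (h : ¬ P.Active r i n) : ¬ γ.sharedClock :=
  (not_or.1 h).1

/-- This makes perfect recall applicable to response steps even without a shared clock. -/
theorem active_of_responds {n : ℕ} (h : P.Responds r i n) : P.Active r i n :=
  Or.inr fun hi => hi.2.2 h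

/-- An empty record means that no step was active. -/
theorem not_active_of_recorded_eq_nil {n : ℕ} (h : P.recorded r i n = []) {u : ℕ} (hu : u < n) :
    ¬ P.Active r i u := by
  induction n with
  | zero => omega
  | succ n ih =>
    by_cases ha : P.Active r i n
    · rw [recorded_succ_of_active ha] at h
      simp at h
    · rw [recorded_succ_of_not_active ha] at h
      rcases Nat.lt_succ_iff_lt_or_eq.1 hu with hlt | rfl
      · exact ih h hlt
      · exact ha

theorem before_eq_initial {n : ℕ} (h : ∀ u < n, ¬ P.Active r i u) : r.before i n = r.initial i := by
  induction n with
  | zero => rfl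
  | succ n ih =>
    rw [before_succ_of_not_active (h n n.lt_succ_self)]
    exact ih fun u hu => h u (hu.trans n.lt_succ_self)

/-- If some step before time `n` was active, then the state at time `n` was set by the last such
step. -/
theorem exists_last_active {n : ℕ} (h : ∃ u < n, P.Active r i u) :
    ∃ u < n, P.Active r i u ∧ r.before i (u + 1) = r.before i n := by
  induction n with
  | zero => obtain ⟨u, hu, -⟩ := h; omega
  | succ n ih =>
    by_cases ha : P.Active r i n
    · exact ⟨n, n.lt_succ_self, ha, rfl⟩
    · obtain ⟨u, hu, hua⟩ := h
      have hun : u < n := by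
        rcases Nat.lt_succ_iff_lt_or_eq.1 hu with hlt | rfl
        · exact hlt
        · exact absurd hua ha
      obtain ⟨v, hv, hva, hvb⟩ := ih ⟨u, hun, hua⟩
      exact ⟨v, hv.trans n.lt_succ_self, hva, hvb.trans (before_succ_of_not_active ha).symm⟩

theorem IsRun.before_succ_congr (hr : P.IsRun r) (hs : P.IsRun s) {t t' : ℕ}
    (hb : r.before i t = s.before i t') (ho : r.observed i t = s.observed i t')
    (h : γ.sharedClock → t = t') : r.before i (t + 1) = s.before i (t' + 1) := by
  change r.state t i = s.state t' i
  rw [hr.state_eq, hs.state_eq, actionAt_congr hb ho h]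

/-- Equal records stem from matching active steps, and lead to equal states. -/
theorem IsRun.recall (hr : P.IsRun r) (hs : P.IsRun s) (hi : r.initial i = s.initial i) (n m : ℕ)
    (hnm : γ.sharedClock → n = m) (h : P.recorded r i n = P.recorded s i m) :
    r.before i n = s.before i m ∧ ∀ u < n, P.Active r i u → ∃ u' < m,
      r.before i u = s.before i u' ∧ r.observed i u = s.observed i u' ∧
        (γ.sharedClock → u = u') := by
  -- The sum is the induction parameter because idle steps are stripped from either side
  -- independently.
  induction hk : n + m using Nat.strong_induction_on generalizing n m with
  | _ k ih =>
  subst hk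
  rcases n with _ | n
  · refine ⟨?_, fun u hu => absurd hu (Nat.not_lt_zero u)⟩
    exact (before_eq_initial fun u hu => not_active_of_recorded_eq_nil
      (h.symm.trans recorded_zero) hu).symm ▸ hi
  by_cases hn : P.Active r i n
  · rcases m with _ | m
    · rw [recorded_succ_of_active hn, recorded_zero] at h
      simp at h
    by_cases hm : P.Active s i m
    · rw [recorded_succ_of_active hn, recorded_succ_of_active hm] at h
      obtain ⟨h1, h2⟩ := List.append_inj' h rfl
      have ho : r.observed i n = s.observed i m := by simpa using h2
      have hnm' : γ.sharedClock → n = m := fun hc => Nat.succ_injective (hnm hc)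
      obtain ⟨hb, hu⟩ := ih (n + m) (by omega) n m hnm' h1 rfl
      refine ⟨hr.before_succ_congr hs hb ho hnm', fun u hun hua => ?_⟩
      rcases Nat.lt_succ_iff_lt_or_eq.1 hun with hlt | rfl
      · obtain ⟨u', hu', hrest⟩ := hu u hlt hua
        exact ⟨u', by omega, hrest⟩
      · exact ⟨m, m.lt_succ_self, hb, ho, hnm'⟩
    · rw [recorded_succ_of_not_active hm] at h
      -- The times get out of step here, harmlessly: an inactive step exists only without a shared
      -- clock.
      obtain ⟨hb, hu⟩ := ih (n + 1 + m) (by omega) (n + 1) m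
        (fun hc => absurd hc (not_sharedClock_of_not_active hm)) h rfl
      refine ⟨hb.trans (before_succ_of_not_active hm).symm, fun u hun hua => ?_⟩
      obtain ⟨u', hu', hrest⟩ := hu u hun hua
      exact ⟨u', by omega, hrest⟩
  · rw [recorded_succ_of_not_active hn] at h
    obtain ⟨hb, hu⟩ := ih (n + m) (by omega) n m
      (fun hc => absurd hc (not_sharedClock_of_not_active hn)) h rfl
    refine ⟨(before_succ_of_not_active hn).trans hb, fun u hun hua => ?_⟩
    rcases Nat.lt_succ_iff_lt_or_eq.1 hun with hlt | rfl
    · exact hu u hlt hua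
    · exact absurd hua hn

/-- Perfect recall: indistinguishable points of a full-information protocol have matching active
steps in their past. -/
theorem FullInformation.exists_matching_step (hP : P.FullInformation) {p q : P.runs × ℕ}
    (h : Indistinguishable i p q) {u : ℕ} (hu : u ≤ p.2) (ha : P.Active p.1.1 i u) :
    ∃ u' ≤ q.2, p.1.1.before i u = q.1.1.before i u' ∧
      p.1.1.observed i u = q.1.1.observed i u' ∧ (γ.sharedClock → u = u') := by
  have hh := hP.remembers i p.1.1 p.1.2 q.1.1 q.1.2 p.2 q.2 h.1 h.2
  rw [localHistory_eq, localHistory_eq, Prod.mk.injEq] at hh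
  obtain ⟨u', hu', hrest⟩ := (IsRun.recall p.1.2 q.1.2 hh.1 (p.2 + 1) (q.2 + 1)
    (fun hc => by rw [h.2 hc]) hh.2).2 u (Nat.lt_succ_of_le hu) ha
  exact ⟨u', Nat.le_of_lt_succ hu', hrest⟩

/-! ### Runs without further inputs -/

/-- The inputs of `r` before time `n`. -/
def quietInputs (r : γ.Trace) (n t : ℕ) : Set γ.Input := {e | t < n ∧ e ∈ r.inputs t}

/-- Messages sent before time `n` are delivered as in `r`; afterwards, the messages `X` sent in the
previous step are delivered. -/
def quietDeliveries (r : γ.Trace) (n t : ℕ) (X : Set γ.Delivery) : Set γ.Delivery :=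
  {d | (d.sentAt < n ∧ d ∈ r.deliveries t) ∨ (n ≤ d.sentAt ∧ d.sentAt + 1 = t ∧ d ∈ X)}

/-- The states just before time `t` and the messages sent in the previous step, in the run that
agrees with `r` before time `n` and has no inputs from then on. -/
def quietStage (P : γ.Protocol) (r : γ.Trace) (n : ℕ) : ℕ → (∀ i, γ.State i) × Set γ.Delivery
  | 0 => (r.initial, ∅)
  | t + 1 =>
    let p := quietStage P r n t
    let a := fun i => P.act i (p.1 i)
      ({e | e.1 ∈ quietInputs r n t},
        {m | ∃ d ∈ quietDeliveries r n t p.2, d.dst = i ∧ d.content = m.1 ∧ d.src = m.2}) t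
    (fun i => (a i).newState, {d | (d.content, ⟨d.dst, d.edge⟩) ∈ (a d.src).sends})

/-- The run that agrees with `r` before time `n` and has no inputs from then on. -/
def quiet (P : γ.Protocol) (r : γ.Trace) (n : ℕ) : γ.Trace where
  initial := r.initial
  state t := (quietStage P r n (t + 1)).1
  inputs := quietInputs r n
  deliveries t := quietDeliveries r n t (quietStage P r n t).2

/-- The recursion precedes the trace `quiet` and so spells out the protocol step by hand. This lemma
and the next two translate it into `actionAt` and `Sent`. -/
theorem quietStage_fst (P : γ.Protocol) (r : γ.Trace) (n t : ℕ) (i : γ.Agent) :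
    (quietStage P r n t).1 i = (quiet P r n).before i t := by
  cases t <;> rfl

theorem quiet_state (P : γ.Protocol) (r : γ.Trace) (n t : ℕ) (i : γ.Agent) :
    (quiet P r n).state t i = (P.actionAt (quiet P r n) i t).newState := by
  simp only [actionAt, ← quietStage_fst]
  rfl

theorem mem_quietStage_snd (P : γ.Protocol) (r : γ.Trace) (n : ℕ) (d : γ.Delivery) :
    d ∈ (quietStage P r n (d.sentAt + 1)).2 ↔ P.Sent (quiet P r n) d := by
  simp only [Sent, actionAt, ← quietStage_fst]
  rfl

theorem mem_quiet_deliveries {n t : ℕ} {d : γ.Delivery} :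
    d ∈ (quiet P r n).deliveries t ↔ (d.sentAt < n ∧ d ∈ r.deliveries t) ∨
      (n ≤ d.sentAt ∧ d.sentAt + 1 = t ∧ P.Sent (quiet P r n) d) := by
  rw [← mem_quietStage_snd]
  refine or_congr Iff.rfl (and_congr_right fun _ => and_congr_right fun h => ?_)
  rw [h]

/-- A message delivered before `n` was sent before `n`, so it keeps its delivery time from `r`. -/
theorem IsRun.quiet_observed (hr : P.IsRun r) {n t : ℕ} (h : t < n) (i : γ.Agent) :
    (quiet P r n).observed i t = r.observed i t := by
  refine Context.Trace.observed_congr ?_ ?_ i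
  · ext e
    exact ⟨fun he => he.2, fun he => ⟨h, he⟩⟩
  · ext d
    rw [mem_quiet_deliveries]
    refine ⟨?_, fun hd => Or.inl ⟨(hr.delivered_in_time d t hd).1.trans h, hd⟩⟩
    rintro (hd | ⟨h1, h2, -⟩)
    · exact hd.2
    · omega

theorem IsRun.quiet_before (hr : P.IsRun r) {n t : ℕ} (h : t ≤ n) (i : γ.Agent) :
    (quiet P r n).before i t = r.before i t := by
  induction t with
  | zero => rfl
  | succ t ih =>
    change (quiet P r n).state t i = r.state t i
    rw [quiet_state, hr.state_eq, actionAt_congr (ih (Nat.le_of_succ_le h))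
      (hr.quiet_observed h i) fun _ => rfl]

theorem IsRun.quiet_actionAt (hr : P.IsRun r) {n t : ℕ} (h : t < n) (i : γ.Agent) :
    P.actionAt (quiet P r n) i t = P.actionAt r i t :=
  actionAt_congr (hr.quiet_before h.le i) (hr.quiet_observed h i) fun _ => rfl

theorem IsRun.quiet_sent (hr : P.IsRun r) {n : ℕ} {d : γ.Delivery} (h : d.sentAt < n) :
    P.Sent (quiet P r n) d ↔ P.Sent r d := by
  rw [Sent, Sent, hr.quiet_actionAt h]

/-- Messages sent from `n` on take one time unit, which is allowed because all bounds are positive.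
-/
theorem IsRun.isRun_quiet (hr : P.IsRun r) (n : ℕ) : P.IsRun (quiet P r n) where
  initial_mem := hr.initial_mem
  state_eq t i := quiet_state P r n t i
  input_once e t t' h h' := hr.input_once e t t' h.2 h'.2
  delivered_once d hd := by
    simp only [mem_quiet_deliveries]
    rcases lt_or_ge d.sentAt n with hn | hn
    · obtain ⟨t, ht, htu⟩ := hr.delivered_once d ((hr.quiet_sent hn).1 hd)
      refine ⟨t, Or.inl ⟨hn, ht⟩, ?_⟩
      rintro t' (h | h)
      · exact htu t' h.2
      · omega
    · refine ⟨d.sentAt + 1, Or.inr ⟨hn, rfl, hd⟩, ?_⟩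
      rintro t' (h | h)
      · omega
      · exact h.2.1.symm
  delivered_sent d t hd := by
    rcases mem_quiet_deliveries.1 hd with h | h
    · exact (hr.quiet_sent h.1).2 (hr.delivered_sent d t h.2)
    · exact h.2.2
  delivered_in_time d t hd := by
    rcases mem_quiet_deliveries.1 hd with h | ⟨-, rfl, -⟩
    · exact hr.delivered_in_time d t h.2
    · refine ⟨d.sentAt.lt_succ_self, ?_⟩
      push_cast
      gcongr
      exact Order.one_le_iff_pos.2 (γ.bound_pos _ _ d.edge)

/-- In a run without inputs nothing is observed at time `0`. -/
theorem IsRun.observed_quiet_zero (hr : P.IsRun r) (i : γ.Agent) :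
    (quiet P r 0).observed i 0 = (∅, ∅) := by
  refine Prod.ext ?_ ?_
  · ext e
    exact ⟨fun h => absurd h.1 (Nat.not_lt_zero 0), fun h => h.elim⟩
  · ext m
    refine ⟨?_, fun h => h.elim⟩
    rintro ⟨d, hd, -⟩
    exact absurd ((hr.isRun_quiet 0).delivered_in_time d 0 hd).1 (Nat.not_lt_zero _)

/-- An agent that takes part in a solution does not respond before the triggering input. -/
theorem input_of_responds {e : γ.Input} {I : Set γ.Agent} (hP : P ∈ eventualResponse e I)
    (hr : P.IsRun r) (hi : i ∈ I) {t : ℕ} (h : P.Responds r i t) : ∃ t' ≤ t, e ∈ r.inputs t' := by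
  by_contra! hne
  -- Cutting the inputs at `t + 1` preserves step `t` and its response, but yields an untriggered
  -- run.
  refine (hP _ (hr.isRun_quiet (t + 1))).2 ?_ i hi t ?_
  · rintro ⟨t', h1, h2⟩
    exact hne t' (Nat.le_of_lt_succ h1) h2
  · rw [Responds, hr.quiet_actionAt t.lt_succ_self]
    exact h

theorem responseTime_eq {t : ℕ} (h : P.Responds r i t) (hmin : ∀ u < t, ¬ P.Responds r i u) :
    P.responseTime r i = t :=
  le_antisymm (iInf₂_le t h) (le_iInf₂ fun u hu =>
    Nat.cast_le.2 (not_lt.1 fun hlt => hmin u hlt hu))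

end Context.Protocol

/-! ### Knowledge and `δ`-common knowledge -/

section Knowledge

open Context Context.Protocol

variable {γ : Context.{u1, u2, u3, u4}}

theorem noLaterThan_trans_right {t' t u : ℕ} {ε : TimeBound} (h : NoLaterThan t' t ε)
    (htu : t ≤ u) : NoLaterThan t' u ε := by
  refine le_trans h ?_
  gcongr
  exact_mod_cast htu

theorem noLaterThan_trans_left {t' t u : ℕ} {ε : TimeBound} (h : NoLaterThan t' t ε)
    (hu : u ≤ t') : NoLaterThan u t ε := by
  refine le_trans ?_ h
  exact_mod_cast hu

theorem noLaterThan_zero {t' t : ℕ} : NoLaterThan t' t 0 ↔ t' ≤ t := by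
  rw [NoLaterThan, add_zero]
  norm_cast

section Sets

variable {R : Set γ.Trace} {i : γ.Agent} {I : Set γ.Agent} {δ : I → I → TimeBound}
  {ψ : Event R} {e : γ.Input}

theorem byTime_stable {ε : TimeBound} {r : R} {t u : ℕ} (h : (r, t) ∈ byTime ε ψ) (htu : t ≤ u) :
    (r, u) ∈ byTime ε ψ :=
  let ⟨t', ht', h'⟩ := h
  ⟨t', noLaterThan_trans_right ht' htu, h'⟩

theorem Indistinguishable.refl (i : γ.Agent) (p : R × ℕ) : Indistinguishable i p p :=
  ⟨rfl, fun _ => rfl⟩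

theorem knows_subset (i : γ.Agent) (ψ : Event R) : knows i ψ ⊆ ψ :=
  fun p hp => hp p (Indistinguishable.refl i p)

theorem Indistinguishable.mem_knows {p q : R × ℕ} (h : Indistinguishable i p q)
    (hp : p ∈ knows i ψ) : q ∈ knows i ψ :=
  fun x hx => hp x ⟨h.1.trans hx.1, fun hc => (h.2 hc).trans (hx.2 hc)⟩

theorem mem_byTime_occurring {p : R × ℕ} :
    p ∈ byTime 0 (occurring R e) ↔ ∃ t ≤ p.2, e ∈ p.1.1.inputs t := by
  simp only [byTime, noLaterThan_zero]
  rfl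

/-- `δ`-common knowledge satisfies its fixed point equation. -/
theorem exists_of_mem_deltaCommonKnowledge {k : I} {p : R × ℕ}
    (h : p ∈ deltaCommonKnowledge I δ ψ k) {j : I} (hj : j ≠ k) :
    ∃ t', NoLaterThan t' p.2 (δ k j) ∧
      (p.1, t') ∈ knows j.1 (ψ ∩ deltaCommonKnowledge I δ ψ j) := by
  have hfix : deltaStep I δ ψ (deltaCommonKnowledge I δ ψ) = deltaCommonKnowledge I δ ψ :=
    OrderHom.map_gfp _
  rw [← hfix] at h
  exact Set.mem_iInter₂.1 h j hj

/-- By the fixed point equation each component is an intersection of `byTime` events, whose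
deadlines only move forward. -/
theorem deltaCommonKnowledge_stable {k : I} {r : R} {t u : ℕ}
    (h : (r, t) ∈ deltaCommonKnowledge I δ ψ k) (htu : t ≤ u) :
    (r, u) ∈ deltaCommonKnowledge I δ ψ k := by
  have hfix : deltaStep I δ ψ (deltaCommonKnowledge I δ ψ) = deltaCommonKnowledge I δ ψ :=
    OrderHom.map_gfp _
  rw [← hfix] at h ⊢
  exact Set.mem_iInter₂.2 fun j hj => byTime_stable (Set.mem_iInter₂.1 h j hj) htu

/-- The component of `k` refers to the trigger only through the knowledge of another agent; with a
single agent the intersection would be empty and the component trivial. -/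
theorem triggered_of_mem_deltaCommonKnowledge (hI : I.Nontrivial) {k : I} {p : R × ℕ}
    (h : p ∈ deltaCommonKnowledge I δ (byTime 0 (occurring R e)) k) : p.1.1.Triggered e := by
  obtain ⟨j, hj, hjk⟩ := hI.exists_ne k.1
  obtain ⟨t', -, h'⟩ := exists_of_mem_deltaCommonKnowledge h
    (j := ⟨j, hj⟩) (fun h => hjk (congrArg Subtype.val h))
  obtain ⟨u, -, hu⟩ := mem_byTime_occurring.1 (knows_subset _ _ h').1
  exact ⟨u, hu⟩

theorem exists_mem_firstTime {r : R} {t : ℕ} (h : (r, t) ∈ ψ) : ∃ u ≤ t, (r, u) ∈ firstTime ψ := by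
  classical
  have hex : ∃ u, (r, u) ∈ ψ := ⟨t, h⟩
  exact ⟨Nat.find hex, Nat.find_min' hex h, Nat.find_spec hex, fun v hv => Nat.find_min hex hv⟩

theorem firstTime_unique {r : R} {t u : ℕ} (ht : (r, t) ∈ firstTime ψ)
    (hu : (r, u) ∈ firstTime ψ) : t = u := by
  rcases lt_trichotomy t u with h | h | h
  · exact absurd ht.1 (hu.2 t h)
  · exact h
  · exact absurd hu.1 (ht.2 u h)

end Sets

/-! ### Stability and locality of knowledge -/

variable {P : γ.Protocol} {i : γ.Agent} {e : γ.Input} {φ : Event P.runs}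

/-- An agent that has not yet taken an active step does not know any event that occurs in triggered
runs only. -/
theorem exists_active_of_mem_knows (hφ : ∀ p ∈ φ, p.1.1.Triggered e) {r : P.runs} {t : ℕ}
    (h : (r, t) ∈ knows i φ) : ∃ u < t + 1, P.Active r.1 i u := by
  by_contra! hne
  have hc : ¬ γ.sharedClock := not_sharedClock_of_not_active (hne 0 t.succ_pos)
  have h0 : P.Idle r.1 i 0 := not_not.1 (not_or.1 (hne 0 t.succ_pos)).2
  have hq := IsRun.isRun_quiet r.2 0
  -- All steps up to `t` being idle, the state is still the one after an idle step `0`, and the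
  -- input-free run also has it at time `0`.
  have hind : Indistinguishable i (r, t) ((⟨_, hq⟩, 0) : P.runs × ℕ) := by
    refine ⟨?_, fun h => absurd h hc⟩
    have h1 : r.1.before i (t + 1) = r.1.initial i := before_eq_initial hne
    have h2 : r.1.before i 1 = r.1.initial i := h0.2.1
    have h3 : (quiet P r.1 0).before i 1 = r.1.before i 1 :=
      hq.before_succ_congr r.2 rfl ((IsRun.observed_quiet_zero r.2 i).trans h0.1.symm)
        fun _ => rfl
    exact h1.trans (h2.symm.trans h3.symm)
  obtain ⟨u, hu, -⟩ := hφ _ (h _ hind)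
  exact absurd hu (Nat.not_lt_zero u)

/-- Under a full-information protocol, knowledge of a stable event that occurs in triggered runs
only is stable. -/
theorem knows_stable (hP : P.FullInformation) (hφ : ∀ p ∈ φ, p.1.1.Triggered e)
    (hst : ∀ (r : P.runs) (t u : ℕ), t ≤ u → (r, t) ∈ φ → (r, u) ∈ φ) {r : P.runs} {t u : ℕ}
    (h : (r, t) ∈ knows i φ) (htu : t ≤ u) : (r, u) ∈ knows i φ := by
  by_cases hc : γ.sharedClock
  · intro q hq
    obtain ⟨t', ht', hb, ho, htt⟩ := hP.exists_matching_step hq htu (Or.inl hc)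
    have hind : Indistinguishable i (r, t) (q.1, t') :=
      ⟨IsRun.before_succ_congr r.2 q.1.2 hb ho htt, htt⟩
    exact hst q.1 t' q.2 ht' (h _ hind)
  · intro q hq
    -- Step `t` itself may be idle and have no match; the last active step `v` up to `t` produced
    -- the same state.
    obtain ⟨v, hv, hva, hvb⟩ := exists_last_active (exists_active_of_mem_knows hφ h)
    obtain ⟨t', ht', hb, ho, htt⟩ :=
      hP.exists_matching_step hq ((Nat.le_of_lt_succ hv).trans htu) hva
    have hind : Indistinguishable i (r, t) (q.1, t') :=
      ⟨hvb.symm.trans (IsRun.before_succ_congr r.2 q.1.2 hb ho htt), fun h => absurd h hc⟩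
    exact hst q.1 t' q.2 ht' (h _ hind)

/-- Whether a stable event that occurs in triggered runs only is known for the first time is
determined by the previous state, the observations and, with a shared clock, the time. -/
theorem firstTime_knows_congr (hP : P.FullInformation) (hφ : ∀ p ∈ φ, p.1.1.Triggered e)
    (hst : ∀ (r : P.runs) (t u : ℕ), t ≤ u → (r, t) ∈ φ → (r, u) ∈ φ) {r s : P.runs} {t t' : ℕ}
    (hb : r.1.before i t = s.1.before i t') (ho : r.1.observed i t = s.1.observed i t')
    (htt : γ.sharedClock → t = t') (h : (r, t) ∈ firstTime (knows i φ)) :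
    (s, t') ∈ firstTime (knows i φ) := by
  have hstate : r.1.state t i = s.1.state t' i := IsRun.before_succ_congr r.2 s.2 hb ho htt
  refine ⟨Indistinguishable.mem_knows (p := (r, t)) ⟨hstate, htt⟩ h.1, fun u hu hk => ?_⟩
  obtain ⟨v, rfl⟩ : ∃ v, t' = v + 1 := Nat.exists_eq_succ_of_ne_zero (by have : u < t' := hu; omega)
  -- Stability moves the earlier knowledge to the last moment before `t'`, where the state is
  -- `before` at `t'`.
  have hkv : (s, v) ∈ knows i φ := knows_stable hP hφ hst hk (Nat.le_of_lt_succ hu)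
  rcases t with _ | w
  -- At `t = 0` there is no earlier point of `r` to compare with. Instead, removing the matching
  -- last steps from the equal histories leaves an empty record for `s`, whereas knowledge at `v`
  -- requires an active step.
  · obtain ⟨x, hx, hxa⟩ := exists_active_of_mem_knows hφ hkv
    have hh := hP.remembers i r.1 r.2 s.1 s.2 0 (v + 1) hstate htt
    rw [localHistory_eq, localHistory_eq, Prod.mk.injEq] at hh
    have hact : P.Active r.1 i 0 ↔ P.Active s.1 i (v + 1) := by
      simp only [Active, Idle, Responds, ho, hstate, hb, actionAt_congr hb ho htt]
    have hnil : P.recorded s.1 i (v + 1) = [] := by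
      have h2 := hh.2
      by_cases ha : P.Active r.1 i 0
      · rw [recorded_succ_of_active ha, recorded_succ_of_active (hact.1 ha)] at h2
        exact (List.append_inj' h2 rfl).1.symm
      · rw [recorded_succ_of_not_active ha, recorded_succ_of_not_active (mt hact.2 ha)] at h2
        exact h2.symm
    exact not_active_of_recorded_eq_nil hnil hx hxa
  · exact h.2 w w.lt_succ_self (Indistinguishable.mem_knows (p := (s, v)) ⟨hb.symm,
      fun hc => (Nat.succ_injective (htt hc)).symm⟩ hkv)

/-! ### Endowing a protocol with a response logic -/

/-- The protocol that differs from `P` in that `i ∈ I` responds at the points in `φ i`. -/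
def Context.Protocol.endow (P : γ.Protocol) (I : Set γ.Agent) (φ : I → Event P.runs) :
    γ.Protocol where
  initial := P.initial
  act i x o t :=
    { newState := (P.act i x o t).newState
      sends := (P.act i x o t).sends
      respond := (i ∉ I ∧ (P.act i x o t).respond) ∨ ∃ (hi : i ∈ I) (p : P.runs × ℕ),
        p ∈ φ ⟨i, hi⟩ ∧ p.1.1.before i p.2 = x ∧ p.1.1.observed i p.2 = o ∧
          (γ.sharedClock → p.2 = t) }
  clockless hc i x o t t' := by
    simp only [P.clockless hc i x o t t', hc, false_imp_iff]

theorem modifiesResponses_endow (P : γ.Protocol) (I : Set γ.Agent) (φ : I → Event P.runs) :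
    P.ModifiesResponses (P.endow I φ) I where
  initial_eq _ := rfl
  newState_eq _ _ _ _ := rfl
  sends_eq _ _ _ _ := rfl
  respond_eq i hi x o t := by simp [Context.Protocol.endow, hi]

variable {I : Set γ.Agent} {δ : I → I → TimeBound}

/-- `endow` responds wherever the local data agree with those at some point of the logic; `hL`
ensures that this adds no points. -/
theorem exists_endowedWith {L : ∀ P : γ.Protocol, I → Event P.runs}
    (hL : ∀ (k : I) (r s : P.runs) (t t' : ℕ), r.1.before k.1 t = s.1.before k.1 t' →
      r.1.observed k.1 t = s.1.observed k.1 t' → (γ.sharedClock → t = t') →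
      (r, t) ∈ L P k → (s, t') ∈ L P k) : ∃ P', EndowedWith I L P P' := by
  refine ⟨P.endow I (L P), modifiesResponses_endow P I _, fun r k t => ⟨?_, fun h => ?_⟩⟩
  · rintro (⟨hk, -⟩ | ⟨_, p, hp, hb, ho, ht⟩)
    · exact absurd k.2 hk
    · exact hL k p.1 r p.2 t hb ho ht hp
  · exact Or.inr ⟨k.2, (r, t), h, rfl, rfl, fun _ => rfl⟩

/-! ### Responses in a solution, and optimality -/

/-- The event that `i` has responded. -/
def responded (P : γ.Protocol) (i : γ.Agent) : Event P.runs :=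
  {p | ∃ t ≤ p.2, P.Responds p.1.1 i t}

/-- At the time of its response, an agent knows that it has responded, and that the triggering
input has occurred. -/
theorem knows_of_responds (hF : P.FullInformation) (hP : P ∈ eventualResponse e I) (hi : i ∈ I)
    {r : P.runs} {t : ℕ} (h : P.Responds r.1 i t) :
    (r, t) ∈ knows i (byTime 0 (occurring P.runs e) ∩ responded P i) := by
  intro q hq
  obtain ⟨t', ht', hb, ho, htt⟩ := hF.exists_matching_step hq le_rfl (active_of_responds h)
  have hresp : P.Responds q.1.1 i t' := by
    rw [Responds, ← actionAt_congr hb ho htt]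
    exact h
  obtain ⟨u, hu, hue⟩ := input_of_responds hP q.1.2 hi hresp
  exact ⟨mem_byTime_occurring.2 ⟨u, hu.trans ht', hue⟩, t', ht', hresp⟩

/-- In a solution, an agent that responds knows that `δ`-common knowledge holds. -/
theorem knows_deltaCommonKnowledge_of_responds (hF : P.FullInformation)
    (hP : P ∈ timelyResponse e I δ) (k : I) {r : P.runs} {t : ℕ} (h : P.Responds r.1 k.1 t) :
    (r, t) ∈ knows k.1 (deltaCommonKnowledge I δ (byTime 0 (occurring P.runs e)) k) := by
  have hle : (fun k : I => responded P k.1) ≤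
      deltaCommonKnowledge I δ (byTime 0 (occurring P.runs e)) := by
    -- Coinduction: the witness for `j` is its own response time, at which it knows that it has
    -- responded.
    refine OrderHom.le_gfp _ fun k p hp => Set.mem_iInter₂.2 fun j hj => ?_
    obtain ⟨t, ht, hresp⟩ := hp
    obtain ⟨u, -, hu⟩ := input_of_responds hP.1 p.1.2 k.2 hresp
    have htrig : p.1.1.Triggered e := ⟨u, hu⟩
    obtain ⟨τ, hτ, hτr⟩ := hP.2 p.1.1 p.1.2 htrig
    have hτ_eq : ∀ (l : I) (v : ℕ), P.Responds p.1.1 l.1 v → τ l = v := fun l v hv => by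
      have huniq := (hP.1 p.1.1 p.1.2).1 htrig l.1 l.2
      have := responseTime_eq hv fun w hw hw' => hw.ne (huniq.unique hw' hv)
      exact_mod_cast (hτr l).symm.trans this
    obtain ⟨v, hv, -⟩ := (hP.1 p.1.1 p.1.2).1 htrig j.1 j.2
    refine ⟨v, ?_, knows_of_responds hF hP.1 j.2 hv⟩
    have hδ := hτ k j hj.symm
    rw [hτ_eq k t hresp, hτ_eq j v hv] at hδ
    exact noLaterThan_trans_right hδ ht
  exact knows_mono _ (Set.inter_subset_right.trans (hle k)) (knows_of_responds hF hP.1 k.2 h)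

end Knowledge

theorem mainTheorem4 (γ : Context.{u1, u2, u3, u4}) (e : γ.Input) (I : Set γ.Agent)
    (hI : I.Nontrivial) (δ : I → I → TimeBound) :
    IsOptimalResponseLogic (timelyResponse e I δ) I (fun P i =>
      firstTime (knows i.1 (deltaCommonKnowledge I δ (byTime 0 (occurring P.runs e)) i))) := by
  intro P hP hF
  refine ⟨exists_endowedWith fun k r s t t' hb ho htt h => firstTime_knows_congr hF
    (fun p hp => triggered_of_mem_deltaCommonKnowledge hI hp)
    (fun r t u htu h => deltaCommonKnowledge_stable h htu) hb ho htt h, ?_⟩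
  rintro P' ⟨hmod, hresp⟩
  have hruns : P'.runs = P.runs := hmod.runs_eq
  have hearly : ∀ (r : P.runs) (k : I) (t : ℕ), P.Responds r.1 k.1 t →
      ∃ u ≤ t, P'.Responds r.1 k.1 u := fun r k t h => by
    obtain ⟨u, hu, hfirst⟩ :=
      exists_mem_firstTime (knows_deltaCommonKnowledge_of_responds hF hP k h)
    exact ⟨u, hu, (hresp r k u).2 hfirst⟩
  have hunique : ∀ (r : P.runs) (k : I) (t u : ℕ), P'.Responds r.1 k.1 t →
      P'.Responds r.1 k.1 u → t = u := fun r k t u ht hu =>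
    firstTime_unique ((hresp r k t).1 ht) ((hresp r k u).1 hu)
  have hexists : ∀ (r : P.runs), r.1.Triggered e → ∀ k : I, ∃ t, P'.Responds r.1 k.1 t :=
    fun r hr k => by
      obtain ⟨t, ht, -⟩ := (hP.1 r.1 r.2).1 hr k.1 k.2
      obtain ⟨u, -, hu⟩ := hearly r k t ht
      exact ⟨u, hu⟩
  refine ⟨⟨fun r hr => ?_, fun r hr htrig => ?_⟩, fun r hr i hi => ?_⟩
  · rw [hruns] at hr
    refine ⟨fun htrig i hi => ?_, fun hnt i hi t ht => ?_⟩
    · obtain ⟨t, ht⟩ := hexists ⟨r, hr⟩ htrig ⟨i, hi⟩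
      exact ⟨t, ht, fun u hu => hunique ⟨r, hr⟩ ⟨i, hi⟩ u t hu ht⟩
    · have h := ((hresp ⟨r, hr⟩ ⟨i, hi⟩ t).1 ht).1
      exact hnt (triggered_of_mem_deltaCommonKnowledge hI (knows_subset _ _ h))
  · rw [hruns] at hr
    choose τ hτ using hexists ⟨r, hr⟩ htrig
    refine ⟨τ, fun k j hkj => ?_, fun k => Context.Protocol.responseTime_eq (hτ k) fun u hu hu' =>
      hu.ne (hunique ⟨r, hr⟩ k u (τ k) hu' (hτ k))⟩
    have h := knows_subset _ _ ((hresp ⟨r, hr⟩ k (τ k)).1 (hτ k)).1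
    obtain ⟨t', ht', hk⟩ := exists_of_mem_deltaCommonKnowledge h hkj.symm
    -- By time `t'` agent `j` knows its component, so its first such time, which is its response
    -- time, meets the deadline too.
    obtain ⟨u, hu, hfirst⟩ := exists_mem_firstTime (knows_mono _ Set.inter_subset_right hk)
    rw [hunique ⟨r, hr⟩ j (τ j) u (hτ j) ((hresp ⟨r, hr⟩ j u).2 hfirst)]
    exact noLaterThan_trans_left ht' hu
  · refine le_iInf₂ fun t ht => ?_
    obtain ⟨u, hu, hu'⟩ := hearly ⟨r, hr⟩ ⟨i, hi⟩ t ht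
    exact (iInf₂_le u hu').trans (Nat.cast_le.2 hu)
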